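/- An Orlicz N-function is an even convex continuous function $\varphi:\mathbb R\to\mathbb R$ with $\varphi(0)=0$, $\varphi(x)>0$ for $x\ne0$, $\varphi(x)/x\to0$ as $x\to0$ and $\varphi(x)/x\to\infty$ as $x\to\infty$. Let $\zeta\ge2$ and let $\varphi$ be an Orlicz N-function such that $\lim_{x\to0}\varphi(x)/x^2$ exists in $(0,\infty]$ and $\varphi(t)=t^\zeta/\zeta$ for $t>1$. A random variable $\xi$ on a probability space $(\Omega,\mathcal F,P)$ is $\varphi$-sub-Gaussian if, for some $a\ge0$, $E\exp\{\lambda\xi\}\le\exp\{\varphi(a\lambda)\}$ for all $\lambda\in\mathbb R$; the infimum of such $a$ is denoted $\tau_\varphi(\xi)$. Let $T>0$ and let $X=\{X(t),\,t\in[0,T]\}$ be a separable stochastic process such that every $X(t)$ is $\varphi$-sub-Gaussian. Suppose that, for constants $C\ge0$ and $\alpha\in(0,1)$, $$\sup_{t,s\in[0,T],\ |t-s|\le h}\tau_\varphi(X(t)-X(s))\le Ch^\alpha\qquad\text{for all }h>0.$$ Put $\beta=C(T/2)^\alpha$, $\gamma=\sup_{u\in[0,T]}\tau_\varphi(X(u))$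 and $\nu=\min\{\beta,\gamma\}$. Then $X$ is bounded on $[0,T]$ with probability $1$. Moreover, if $\nu>0$, then for every $$x>\frac{\gamma(\nu^{\zeta-1}+1)+\sqrt{\gamma^2(\nu^{\zeta-1}+1)^2+4\nu^{\zeta-1}\left(C^\zeta(T/2)^{\alpha\zeta}-\gamma^2\right)}}{2\nu^{\zeta-1}}$$ one has $$P\Big\{\sup_{t\in[0,T]}X(t)>x\Big\}\le Z(x),\qquad P\Big\{\inf_{t\in[0,T]}X(t)<-x\Big\}\le Z(x),\qquad P\Big\{\sup_{t\in[0,T]}|X(t)|>x\Big\}\le2Z(x),$$ where $$Z(x)=\exp\left\{-(x-\gamma)^{\frac{\zeta}{\zeta-1}}\,\frac{(\zeta-1)\,x^{\frac1{\zeta-1}}}{\zeta\left(\gamma^\zeta(x-\gamma)+\beta^\zeta\gamma\right)^{\frac1{\zeta-1}}}\right\}\cdot2\left(\frac{ex}{\gamma}\right)^{1/\alpha}.$$ -/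

import Mathlib

open MeasureTheory ProbabilityTheory Filter Topology

/-- An Orlicz N-function: an even, convex, continuous function vanishing only at `0`, with
`φ x / x → 0` as `x → 0` and `φ x / x → ∞` as `x → ∞`. -/
structure IsOrliczNFunction (φ : ℝ → ℝ) : Prop where
  even : ∀ x, φ (-x) = φ x
  convexOn : ConvexOn ℝ Set.univ φ
  continuous : Continuous φ
  map_zero : φ 0 = 0
  pos : ∀ x, x ≠ 0 → 0 < φ x
  tendsto_zero : Tendsto (fun x => φ x / x) (𝓝[≠] 0) (𝓝 0)
  tendsto_atTop : Tendsto (fun x => φ x / x) atTop atTop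

/-- Assumption Q on the behaviour at the origin: `φ x / x ^ 2` has a limit `c > 0` as `x → 0`;
the value `c = ∞` is allowed. -/
def AssumptionQ (φ : ℝ → ℝ) : Prop :=
  ∃ c : ENNReal, 0 < c ∧ Tendsto (fun x => ENNReal.ofReal (φ x / x ^ 2)) (𝓝[≠] 0) (𝓝 c)

section SubGaussian

variable {Ω : Type*} [MeasurableSpace Ω]

/-- `E exp (l ξ) ≤ exp (φ (a l))` for all real `l`, the expectation being finite. -/
def SubGaussianBound (φ : ℝ → ℝ) (ξ : Ω → ℝ) (μ : Measure Ω) (a : ℝ) : Prop :=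
  ∀ l : ℝ, Integrable (fun ω => Real.exp (l * ξ ω)) μ ∧
    ∫ ω, Real.exp (l * ξ ω) ∂μ ≤ Real.exp (φ (a * l))

/-- `ξ` is a `φ`-sub-Gaussian random variable, i.e. it belongs to `Sub_φ(Ω)`. -/
def IsPhiSubGaussian (φ : ℝ → ℝ) (ξ : Ω → ℝ) (μ : Measure Ω) : Prop :=
  AEMeasurable ξ μ ∧ ∃ a : ℝ, 0 ≤ a ∧ SubGaussianBound φ ξ μ a

/-- The `φ`-sub-Gaussian standard `τ_φ(ξ)`. -/
noncomputable def phiStandard (φ : ℝ → ℝ) (ξ : Ω → ℝ) (μ : Measure Ω) : ℝ :=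
  sInf {a : ℝ | 0 ≤ a ∧ SubGaussianBound φ ξ μ a}

/-- Separability of a real process on a topological space `B`: for some countable dense set `S`,
outside one null set of `ω`, for every open `U` and every closed interval `F` (bounded or not),
the path takes its values in `F` on all of `U` as soon as it does so on `U ∩ S`.
(Separability with respect to all closed sets `F`, and path continuity, both imply this.) -/
def IsSeparableProcess {B : Type*} [TopologicalSpace B] (X : B → Ω → ℝ) (μ : Measure Ω) : Prop :=
  ∃ S : Set B, S.Countable ∧ Dense S ∧
    ∀ᵐ ω ∂μ, ∀ U : Set B, IsOpen U → ∀ F : Set ℝ, IsClosed F → F.OrdConnected →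
      (∀ t ∈ U ∩ S, X t ω ∈ F) → ∀ t ∈ U, X t ω ∈ F

/-- `γ`, the supremum over the parameter set of the standards of `X u`
(equivalently `γ ^ ζ = sup_u τ_φ(X u) ^ ζ`). -/
noncomputable def supStandard {B : Type*} (φ : ℝ → ℝ) (X : B → Ω → ℝ) (μ : Measure Ω) : ℝ :=
  ⨆ u : B, phiStandard φ (X u) μ

end SubGaussian

/-- The tail bound `Z(x)`. -/
noncomputable def tailBound (ζ α β γ x : ℝ) : ℝ :=
  Real.exp (-((x - γ) ^ (ζ / (ζ - 1)) *
      (((ζ - 1) * x ^ (1 / (ζ - 1))) /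
        (ζ * (γ ^ ζ * (x - γ) + β ^ ζ * γ) ^ (1 / (ζ - 1)))))) *
    (2 * (Real.exp 1 * x / γ) ^ (1 / α))

/-- The threshold for `x`, the larger root of a quadratic equation. -/
noncomputable def tailThreshold (ζ α C T γ ν : ℝ) : ℝ :=
  (γ * (ν ^ (ζ - 1) + 1) +
      Real.sqrt (γ ^ 2 * (ν ^ (ζ - 1) + 1) ^ 2 +
        4 * ν ^ (ζ - 1) * (C ^ ζ * (T / 2) ^ (α * ζ) - γ ^ 2))) /
    (2 * ν ^ (ζ - 1))

/-! Chaining with Hölder weights, followed by a Chernoff bound. For `p` in `(0,1)`, take nets of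
mesh `(T/2) p^((k+1)/α)`, so that the increments from net `k` to net `k+1` have standard at most `β
p^(k+1)`. Hölder's inequality with weights `(1-p) p^k` cancels these powers: every increment costs
at most `φ(βl/(1-p))`, the first net costs `φ(γl/(1-p))`, and the net sizes contribute a convergent
sum. This is `supMomentBound`. It holds for finite sets, passes to countable ones by monotone
convergence, and to the whole interval by separability.

For the tail, take `p = γ/x`, replace `φ(t)` by `t^ζ/ζ + 1/4`, and optimise over `l`. The additive
errors fit into the prefactor 2 of `Z` when `x ≥ 2γ`; for `γ < x ≤ 2γ` one has `Z(x) ≥ 1`. The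
threshold enters only through `x > γ`. -/

/-! ### Orlicz functions against the power `t^ζ/ζ`. -/

namespace IsOrliczNFunction

variable {φ : ℝ → ℝ}

lemma le_of_abs_le (h : IsOrliczNFunction φ) {x y : ℝ} (hxy : |x| ≤ |y|) : φ x ≤ φ y := by
  have key : ∀ z : ℝ, φ |z| = φ z := fun z => by
    rcases abs_choice z with hz | hz <;> rw [hz]
    exact h.even z
  rw [← key y]
  have := h.convexOn.le_max_of_mem_Icc (Set.mem_univ (-|y|)) (Set.mem_univ |y|) (z := x)
    (abs_le.1 hxy)
  rwa [h.even, max_self] at this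

/-- A function equal to `t ^ ζ / ζ` beyond `1` exceeds that power by at most `1 / 4` anywhere. -/
lemma le_rpow_div_add (h : IsOrliczNFunction φ) {ζ : ℝ} (hζ : 2 ≤ ζ)
    (hφζ : ∀ t : ℝ, 1 < t → φ t = t ^ ζ / ζ) {t : ℝ} (ht : 0 ≤ t) :
    φ t ≤ t ^ ζ / ζ + 1 / 4 := by
  have hζ0 : 0 < ζ := by linarith
  rcases lt_or_ge 1 t with h1 | h1
  · rw [hφζ t h1]; linarith
  have hone : φ 1 = 1 / ζ := by
    have h1 : Tendsto φ (𝓝[>] 1) (𝓝 (φ 1)) := h.continuous.continuousWithinAt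
    have h2 : Tendsto (fun t : ℝ => t ^ ζ / ζ) (𝓝[>] 1) (𝓝 ((1 : ℝ) ^ ζ / ζ)) :=
      ((Real.continuous_rpow_const hζ0.le).div_const ζ).continuousWithinAt
    rw [Real.one_rpow] at h2
    refine tendsto_nhds_unique h1 (h2.congr' ?_)
    filter_upwards [self_mem_nhdsWithin] with t ht using (hφζ t ht).symm
  -- On `[0,1]` the graph lies below the chord from `(0, 0)` to `(1, 1/ζ)`.
  have hlin : φ t ≤ t / ζ := by
    have := h.convexOn.2 (Set.mem_univ (0 : ℝ)) (Set.mem_univ (1 : ℝ)) (sub_nonneg.2 h1) ht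
      (by ring)
    simp only [smul_eq_mul, mul_zero, mul_one, zero_add, h.map_zero, hone] at this
    rwa [mul_one_div] at this
  refine hlin.trans ?_
  have hp : 0 ≤ t ^ ζ := Real.rpow_nonneg ht ζ
  have : t ≤ t ^ ζ + ζ / 4 := by
    rcases le_total 4 ζ with h4 | h4
    · linarith
    · have h5 : t ^ (4 : ℕ) ≤ t ^ ζ := by
        rcases ht.eq_or_lt with rfl | ht
        · simpa using hp
        · rw [← Real.rpow_natCast]
          exact Real.rpow_le_rpow_of_exponent_ge ht h1 (by norm_num; exact h4)
      -- The two squares add up to `t^4 - t + 1/2`, and `1/2 ≤ ζ/4`.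
      nlinarith [sq_nonneg (t ^ 2 - 1 / 2), sq_nonneg (t - 1 / 2)]
  calc t / ζ ≤ (t ^ ζ + ζ / 4) / ζ := by gcongr
    _ = _ := by field_simp

end IsOrliczNFunction

/-! ### The standard and sums of sub-Gaussian variables. -/

section Standard

variable {Ω : Type*} [MeasurableSpace Ω] {μ : Measure Ω} {φ : ℝ → ℝ} {ξ η : Ω → ℝ}

lemma SubGaussianBound.mono (hφ : IsOrliczNFunction φ) {a b : ℝ} (ha : 0 ≤ a) (hab : a ≤ b)
    (h : SubGaussianBound φ ξ μ a) : SubGaussianBound φ ξ μ b := fun l =>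
  ⟨(h l).1, (h l).2.trans (Real.exp_le_exp.2 (hφ.le_of_abs_le (by
    rw [abs_mul, abs_mul, abs_of_nonneg ha, abs_of_nonneg (ha.trans hab)]
    gcongr)))⟩

lemma phiStandard_nonneg : 0 ≤ phiStandard φ ξ μ := Real.sInf_nonneg fun _ h => h.1

lemma phiStandard_le {a : ℝ} (ha : 0 ≤ a) (h : SubGaussianBound φ ξ μ a) :
    phiStandard φ ξ μ ≤ a := csInf_le ⟨0, fun _ h => h.1⟩ ⟨ha, h⟩

/-- The infimum defining `τ_φ(ξ)` is attained. -/
lemma IsPhiSubGaussian.bound_phiStandard (hφ : IsOrliczNFunction φ)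
    (h : IsPhiSubGaussian φ ξ μ) : SubGaussianBound φ ξ μ (phiStandard φ ξ μ) := by
  obtain ⟨-, a, ha, hb⟩ := h
  intro l
  refine ⟨(hb l).1, ?_⟩
  have hlim : Tendsto (fun b => Real.exp (φ (b * l))) (𝓝[>] phiStandard φ ξ μ)
      (𝓝 (Real.exp (φ (phiStandard φ ξ μ * l)))) :=
    (Real.continuous_exp.comp
      (hφ.continuous.comp (continuous_id.mul continuous_const))).continuousWithinAt
  refine ge_of_tendsto hlim ?_
  filter_upwards [self_mem_nhdsWithin] with b hb'
  obtain ⟨c, ⟨hc0, hc⟩, hcb⟩ := exists_lt_of_csInf_lt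
    (s := {a : ℝ | 0 ≤ a ∧ SubGaussianBound φ ξ μ a}) ⟨a, ha, hb⟩ hb'
  exact ((hc.mono hφ hc0 hcb.le) l).2

lemma IsPhiSubGaussian.bound_of_le (hφ : IsOrliczNFunction φ)
    (h : IsPhiSubGaussian φ ξ μ) {a : ℝ} (ha : phiStandard φ ξ μ ≤ a) :
    SubGaussianBound φ ξ μ a :=
  (h.bound_phiStandard hφ).mono hφ phiStandard_nonneg ha

/-- The inequality `2uv ≤ u² + v²` for the two exponentials. The constant is crude, but it serves
only to show that standards are finite. -/
lemma SubGaussianBound.add (hφ : IsOrliczNFunction φ) (hξ : AEMeasurable ξ μ)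
    (hη : AEMeasurable η μ) {a b : ℝ} (ha : 0 ≤ a) (hb : 0 ≤ b)
    (h : SubGaussianBound φ ξ μ a) (h' : SubGaussianBound φ η μ b) :
    SubGaussianBound φ (fun ω => ξ ω + η ω) μ (2 * max a b) := by
  intro l
  have hξl := (h.mono hφ ha (le_max_left a b)) (2 * l)
  have hηl := (h'.mono hφ hb (le_max_right a b)) (2 * l)
  have hle : ∀ ω, Real.exp (l * (ξ ω + η ω)) ≤
      (Real.exp (2 * l * ξ ω) + Real.exp (2 * l * η ω)) / 2 := fun ω => by
    have e1 : Real.exp (2 * l * ξ ω) = Real.exp (l * ξ ω) ^ 2 := by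
      rw [← Real.exp_nat_mul]; push_cast; ring_nf
    have e2 : Real.exp (2 * l * η ω) = Real.exp (l * η ω) ^ 2 := by
      rw [← Real.exp_nat_mul]; push_cast; ring_nf
    rw [mul_add, Real.exp_add, e1, e2]
    nlinarith [sq_nonneg (Real.exp (l * ξ ω) - Real.exp (l * η ω))]
  have hint : Integrable
      (fun ω => (Real.exp (2 * l * ξ ω) + Real.exp (2 * l * η ω)) / 2) μ :=
    (hξl.1.add hηl.1).div_const 2
  have hint' : Integrable (fun ω => Real.exp (l * (ξ ω + η ω))) μ := by
    refine hint.mono' ?_ (ae_of_all _ fun ω => ?_)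
    · exact (Real.measurable_exp.comp_aemeasurable
        ((hξ.add hη).const_mul l)).aestronglyMeasurable
    · rw [Real.norm_eq_abs, Real.abs_exp]; exact hle ω
  refine ⟨hint', (integral_mono hint' hint hle).trans ?_⟩
  rw [integral_div, integral_add hξl.1 hηl.1]
  have : max a b * (2 * l) = 2 * max a b * l := by ring
  rw [this] at hξl hηl
  linarith [hξl.2, hηl.2]

lemma SubGaussianBound.neg (hφ : IsOrliczNFunction φ) {a : ℝ}
    (h : SubGaussianBound φ ξ μ a) : SubGaussianBound φ (fun ω => -ξ ω) μ a := fun l => by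
  have := h (-l)
  rw [mul_neg, hφ.even] at this
  simpa using this

/-- Since `sInf ∅ = 0`, a bound on the standard of an increment says something only once the
increment is known to be sub-Gaussian. -/
lemma IsPhiSubGaussian.sub (hφ : IsOrliczNFunction φ) (h : IsPhiSubGaussian φ ξ μ)
    (h' : IsPhiSubGaussian φ η μ) : IsPhiSubGaussian φ (fun ω => ξ ω - η ω) μ := by
  obtain ⟨hm, a, ha, hb⟩ := h
  obtain ⟨hm', a', ha', hb'⟩ := h'
  refine ⟨hm.sub hm', 2 * max a a', by positivity, ?_⟩
  simp only [sub_eq_add_neg]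
  exact hb.add hφ hm hm'.neg ha ha' (hb'.neg hφ)

lemma SubGaussianBound.lintegral_le {a : ℝ} (h : SubGaussianBound φ ξ μ a) (l : ℝ) :
    ∫⁻ ω, ENNReal.ofReal (Real.exp (l * ξ ω)) ∂μ ≤
      ENNReal.ofReal (Real.exp (φ (a * l))) := by
  rw [← ofReal_integral_eq_lintegral_ofReal (h l).1 (ae_of_all _ fun ω => (Real.exp_pos _).le)]
  exact ENNReal.ofReal_le_ofReal (h l).2

end Standard

/-! ### Chaining with Hölder weights. -/

section Chaining

variable {Ω B : Type*} [MeasurableSpace Ω] {μ : Measure Ω}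

/-- One chain of approximations: the exponential of the value at a point of the last net is
bounded by a weighted product of exponential sums over the nets. -/
lemma exp_mul_le_prod_chain (V : ℕ → Finset B) (π : ℕ → B → B)
    (n : ℕ) (hπ : ∀ k < n, ∀ s ∈ V (k + 1), π k s ∈ V k)
    (w : ℕ → ℝ) (hw : ∀ k ≤ n, 0 < w k) (l : ℝ) (x : B → ℝ) {t : B} (ht : t ∈ V n) :
    ENNReal.ofReal (Real.exp (l * x t)) ≤ ∏ k ∈ Finset.range (n + 1),
      (∑ s ∈ V k, ENNReal.ofReal
        (Real.exp (l / w k * (x s - if k = 0 then 0 else x (π (k - 1) s))))) ^ w k := by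
  -- One exponential is the `w k`-th power of a rescaled one, which is at most the sum over the net.
  have step : ∀ k ≤ n, ∀ s ∈ V k, ∀ y : B → ℝ, ENNReal.ofReal (Real.exp (l * y s)) ≤
      (∑ s ∈ V k, ENNReal.ofReal (Real.exp (l / w k * y s))) ^ w k := fun k hk s hs y => by
    have hwk := hw k hk
    calc ENNReal.ofReal (Real.exp (l * y s))
        = ENNReal.ofReal (Real.exp (l / w k * y s)) ^ w k := by
          rw [ENNReal.ofReal_rpow_of_pos (Real.exp_pos _), ← Real.exp_mul]
          congr 2; field_simp
      _ ≤ _ := ENNReal.rpow_le_rpow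
          (Finset.single_le_sum (f := fun s => ENNReal.ofReal (Real.exp (l / w k * y s)))
            (fun _ _ => zero_le) hs) hwk.le
  induction n generalizing t with
  | zero =>
    have := step 0 le_rfl t ht x
    simpa using this
  | succ n ih =>
    rw [Finset.prod_range_succ]
    have h1 := ih (fun k hk => hπ k (by omega)) (fun k hk => hw k (by omega))
      (hπ n (by omega) t ht) (fun k hk => step k (by omega))
    have h2 := step (n + 1) le_rfl t ht (fun s => x s - x (π n s))
    have h3 : l * x t = l * x (π n t) + l * (x t - x (π n t)) := by ring
    rw [h3, Real.exp_add, ENNReal.ofReal_mul (Real.exp_pos _).le]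
    refine mul_le_mul' h1 ?_
    simpa using h2

/-- Chaining with Hölder weights for the exponential moment of a finite maximum. -/
lemma lintegral_iSup_exp_le_prod_chain (X : B → Ω → ℝ) (hX : ∀ t, AEMeasurable (X t) μ)
    (V : ℕ → Finset B) (π : ℕ → B → B)
    (n : ℕ) (hπ : ∀ k < n, ∀ s ∈ V (k + 1), π k s ∈ V k)
    (w : ℕ → ℝ) (hw : ∀ k ≤ n, 0 < w k) (hw1 : ∑ k ∈ Finset.range (n + 1), w k = 1) (l : ℝ)
    (c : ℕ → ENNReal)
    (hc : ∀ k ≤ n, ∀ s ∈ V k, ∫⁻ ω, ENNReal.ofReal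
      (Real.exp (l / w k * (X s ω - if k = 0 then 0 else X (π (k - 1) s) ω))) ∂μ ≤ c k) :
    ∫⁻ ω, ⨆ t ∈ V n, ENNReal.ofReal (Real.exp (l * X t ω)) ∂μ ≤
      ∏ k ∈ Finset.range (n + 1), ((V k).card * c k) ^ w k := by
  set f : ℕ → B → Ω → ENNReal := fun k s ω => ENNReal.ofReal
    (Real.exp (l / w k * (X s ω - if k = 0 then 0 else X (π (k - 1) s) ω))) with hf
  have hmeas : ∀ k s, AEMeasurable (f k s) μ := fun k s => by
    have h1 : AEMeasurable (fun ω => if k = 0 then 0 else X (π (k - 1) s) ω) μ := by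
      split_ifs
      · exact aemeasurable_const
      · exact hX _
    exact (Real.measurable_exp.comp_aemeasurable (((hX s).sub h1).const_mul _)).ennreal_ofReal
  have hle : ∀ k ∈ Finset.range (n + 1), k ≤ n := fun k hk =>
    Nat.lt_succ_iff.1 (Finset.mem_range.1 hk)
  have h1 : ∫⁻ ω, ⨆ t ∈ V n, ENNReal.ofReal (Real.exp (l * X t ω)) ∂μ ≤
      ∫⁻ ω, ∏ k ∈ Finset.range (n + 1), (∑ s ∈ V k, f k s ω) ^ w k ∂μ :=
    lintegral_mono fun ω => iSup₂_le fun t ht =>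
      exp_mul_le_prod_chain V π n hπ w hw l (fun s => X s ω) ht
  have h2 := ENNReal.lintegral_prod_norm_pow_le (μ := μ) (Finset.range (n + 1))
    (f := fun k ω => ∑ s ∈ V k, f k s ω)
    (fun k _ => Finset.aemeasurable_fun_sum _ fun s _ => hmeas k s) hw1
    (fun k hk => (hw k (hle k hk)).le)
  refine h1.trans (h2.trans (Finset.prod_le_prod' fun k hk => ?_))
  refine ENNReal.rpow_le_rpow ?_ (hw k (hle k hk)).le
  rw [lintegral_finsetSum' _ fun s _ => hmeas k s, ← nsmul_eq_mul]
  exact Finset.sum_le_card_nsmul _ _ _ (hc k (hle k hk))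

end Chaining

/-! ### Nets in an interval. -/

section Interval

/-- An interval of length `T` has a `T / (2 N)`-net of at most `N` points. -/
lemma exists_finset_Icc_net {T : ℝ} (hT : 0 < T) {N : ℕ} (hN : 0 < N) :
    ∃ V : Finset (Set.Icc (0 : ℝ) T), V.card ≤ N ∧
      ∀ t : Set.Icc (0 : ℝ) T, ∃ s ∈ V, |(t : ℝ) - s| ≤ T / (2 * N) := by
  classical
  have hN' : (0 : ℝ) < N := by exact_mod_cast hN
  -- The net consists of the midpoints of `N` equal subintervals; below, `t = T` is treated apart
  -- because the floor would give the index `N`.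
  have hmem : ∀ j : Fin N, T * (2 * (j : ℝ) + 1) / (2 * N) ∈ Set.Icc (0 : ℝ) T := fun j => by
    have hj : ((j : ℕ) : ℝ) + 1 ≤ N := by exact_mod_cast j.2
    refine ⟨by positivity, ?_⟩
    rw [div_le_iff₀ (by positivity)]
    nlinarith
  refine ⟨Finset.univ.image fun j : Fin N => ⟨_, hmem j⟩,
    Finset.card_image_le.trans (by simp), fun t => ?_⟩
  obtain ⟨j, hj1, hj2⟩ : ∃ j : Fin N, (j : ℝ) * T ≤ t * N ∧ (t : ℝ) * N ≤ ((j : ℝ) + 1) * T := by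
    rcases t.2.2.lt_or_eq with h | h
    · have h0 : 0 ≤ (t : ℝ) * N / T := div_nonneg (mul_nonneg t.2.1 hN'.le) hT.le
      refine ⟨⟨⌊(t : ℝ) * N / T⌋₊, (Nat.floor_lt h0).2 ?_⟩, ?_, ?_⟩
      · rw [div_lt_iff₀ hT]; nlinarith
      · exact (le_div_iff₀ hT).1 (Nat.floor_le h0)
      · exact ((div_lt_iff₀ hT).1 (Nat.lt_floor_add_one _)).le
    · refine ⟨⟨N - 1, by omega⟩, ?_, ?_⟩ <;> simp only [Nat.cast_pred hN, h] <;> nlinarith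
  refine ⟨_, Finset.mem_image_of_mem _ (Finset.mem_univ j), ?_⟩
  have : (t : ℝ) - T * (2 * (j : ℝ) + 1) / (2 * N) =
      (2 * (t * N) - T * (2 * (j : ℝ) + 1)) / (2 * N) := by field_simp
  simp only [this]
  rw [abs_div, abs_of_pos (by positivity : (0 : ℝ) < 2 * N)]
  gcongr
  rw [abs_le]
  constructor <;> linarith

end Interval

/-! ### Exponential moment of the supremum. -/

section Chaining

variable {Ω : Type*} [MeasurableSpace Ω] {μ : Measure Ω}

lemma sum_range_geometric_mul_succ (p : ℝ) (n : ℕ) :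
    (∑ k ∈ Finset.range n, (1 - p) * p ^ k * ((k : ℝ) + 1)) * (1 - p) =
      1 - p ^ n - n * p ^ n * (1 - p) := by
  induction n with
  | zero => simp
  | succ n ih => rw [Finset.sum_range_succ, add_mul, ih]; push_cast; ring

/-- The weighted sum of the logarithms of the factors in the chaining bound. -/
lemma sum_range_chain_weights (p q r a b : ℝ) (n : ℕ) :
    ∑ k ∈ Finset.range (n + 1),
        (1 - p) * p ^ k * (((k : ℝ) + 1) * q + r + if k = 0 then a else b) =
      (∑ k ∈ Finset.range (n + 1), (1 - p) * p ^ k * ((k : ℝ) + 1)) * q +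
        (1 - p ^ (n + 1)) * r + (1 - p) * a + (p - p ^ (n + 1)) * b := by
  induction n with
  | zero => simp; ring
  | succ n ih =>
    rw [Finset.sum_range_succ, ih, Finset.sum_range_succ _ (n + 1), if_neg n.succ_ne_zero]
    push_cast
    ring

/-- Equivalent to `p log(1/p) ≤ 1 - p`. It turns the entropy sum into the factor `(e/p)^(1/α)`,
which is `(ex/γ)^(1/α)` at `p = γ/x`. -/
lemma neg_log_div_one_sub_le {p : ℝ} (hp0 : 0 < p) (hp1 : p < 1) :
    -Real.log p / (1 - p) ≤ -Real.log p + 1 := by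
  rw [div_le_iff₀ (by linarith)]
  have h := Real.log_le_sub_one_of_pos (inv_pos.2 hp0)
  rw [Real.log_inv] at h
  have : p * -Real.log p ≤ p * (p⁻¹ - 1) := by gcongr
  have e : p * (p⁻¹ - 1) = 1 - p := by field_simp
  nlinarith

/-- Nets of geometrically decreasing mesh in an interval. -/
lemma exists_finset_Icc_net_exp {T : ℝ} (hT : 0 < T) {α : ℝ} (hα0 : 0 < α) (hα1 : α < 1)
    {p : ℝ} (hp0 : 0 < p) (hp1 : p < 1) (k : ℕ) :
    ∃ V : Finset (Set.Icc (0 : ℝ) T),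
      (V.card : ℝ) ≤ Real.exp (((k : ℝ) + 1) * (-Real.log p / α) + Real.log (1 + p)) ∧
      ∀ t : Set.Icc (0 : ℝ) T, ∃ s ∈ V,
        |(t : ℝ) - s| ≤ T / 2 * Real.exp (-(((k : ℝ) + 1) * (-Real.log p / α))) := by
  set y := Real.exp (((k : ℝ) + 1) * (-Real.log p / α)) with hy
  have hy0 : 0 < y := Real.exp_pos _
  have hL : 0 < -Real.log p := neg_pos.2 (Real.log_neg hp0 hp1)
  -- Here `y = p^(-(k+1)/α) ≥ 1/p` because `α < 1`, so rounding up costs only a factor: `⌈y⌉ ≤ y + 1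
  -- ≤ (1 + p) y`.
  have hpy : 1 ≤ p * y := by
    have e : p = Real.exp (Real.log p) := (Real.exp_log hp0).symm
    rw [hy]
    nth_rw 1 [e]
    rw [← Real.exp_add]
    refine Real.one_le_exp ?_
    have h1 : -Real.log p ≤ -Real.log p / α := by
      rw [le_div_iff₀ hα0]; nlinarith
    have h2 : (0 : ℝ) ≤ k := k.cast_nonneg
    nlinarith
  obtain ⟨V, hV, hnet⟩ := exists_finset_Icc_net hT (Nat.ceil_pos.2 hy0)
  refine ⟨V, ?_, fun t => ?_⟩
  · rw [Real.exp_add, Real.exp_log (by linarith)]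
    have h1 : (V.card : ℝ) ≤ ⌈y⌉₊ := by exact_mod_cast hV
    have h2 := (Nat.ceil_lt_add_one hy0.le).le
    nlinarith
  · obtain ⟨s, hs, h⟩ := hnet t
    refine ⟨s, hs, h.trans ?_⟩
    rw [Real.exp_neg, ← hy, ← div_eq_mul_inv, div_div]
    gcongr
    exact Nat.le_ceil y

lemma prod_ofReal_exp_rpow_le {ι : Type*} (s : Finset ι) (f : ι → ENNReal) (w e : ι → ℝ)
    (hw : ∀ i ∈ s, 0 ≤ w i) (hf : ∀ i ∈ s, f i ≤ ENNReal.ofReal (Real.exp (e i))) :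
    ∏ i ∈ s, f i ^ w i ≤ ENNReal.ofReal (Real.exp (∑ i ∈ s, w i * e i)) := by
  rw [Real.exp_sum, ENNReal.ofReal_prod_of_nonneg fun i _ => (Real.exp_pos _).le]
  refine Finset.prod_le_prod' fun i hi => ?_
  refine (ENNReal.rpow_le_rpow (hf i hi) (hw i hi)).trans ?_
  rw [ENNReal.ofReal_rpow_of_pos (Real.exp_pos _), ← Real.exp_mul, mul_comm]

/-- The bound for the exponential moment of the supremum of a process with Hölder continuous
standards. -/
noncomputable def supMomentBound (φ : ℝ → ℝ) (α β γ p l : ℝ) : ℝ :=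
  (1 - Real.log p) / α + Real.log (1 + p) + (1 - p) * φ (γ * (l / (1 - p))) +
    p * φ (β * (l / (1 - p)))

variable {φ : ℝ → ℝ} {T : ℝ} {X : Set.Icc (0 : ℝ) T → Ω → ℝ} {C α β γ p : ℝ}

/-- The chain is stopped after `m + 1` nets and `F` itself is the last level, so its size enters
only with the leftover Hölder weight `p^(m+1)`. -/
lemma lintegral_iSup_finset_exp_le_of_level (hφ : IsOrliczNFunction φ) (hT : 0 < T)
    (hX : ∀ t, IsPhiSubGaussian φ (X t) μ) (hC : 0 ≤ C) (hα0 : 0 < α) (hα1 : α < 1)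
    (hσ : ∀ h : ℝ, 0 < h → ∀ t s : Set.Icc (0 : ℝ) T, |(t : ℝ) - (s : ℝ)| ≤ h →
      phiStandard φ (fun ω => X t ω - X s ω) μ ≤ C * h ^ α)
    (hβ : β = C * (T / 2) ^ α) (hγ : ∀ t, phiStandard φ (X t) μ ≤ γ)
    (hp0 : 0 < p) (hp1 : p < 1) (l : ℝ) (F : Finset (Set.Icc (0 : ℝ) T)) (m : ℕ) :
    ∫⁻ ω, ⨆ t ∈ F, ENNReal.ofReal (Real.exp (l * X t ω)) ∂μ ≤
      ENNReal.ofReal (Real.exp (supMomentBound φ α β γ p l +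
        p ^ (m + 1) * Real.log (F.card + 1))) := by
  have hq : 0 < 1 - p := by linarith
  have hL : 0 < -Real.log p := neg_pos.2 (Real.log_neg hp0 hp1)
  have hβ0 : 0 ≤ β := by rw [hβ]; positivity
  choose V hVcard hVnet using fun k => exists_finset_Icc_net_exp hT hα0 hα1 hp0 hp1 k
  choose π hπV hπ using hVnet
  set A := φ (γ * (l / (1 - p))) with hA
  set D := φ (β * (l / (1 - p))) with hD
  set n := m + 1 with hn
  let W : ℕ → Finset (Set.Icc (0 : ℝ) T) := fun k => if k < n then V k else F
  let w : ℕ → ℝ := fun k => if k < n then (1 - p) * p ^ k else p ^ n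
  have hWn : W n = F := if_neg (lt_irrefl n)
  have hwn : w n = p ^ n := if_neg (lt_irrefl n)
  have hw : ∀ k ≤ n, 0 < w k := fun k _ => by
    simp only [w]; split_ifs <;> positivity
  have hsum : ∀ e : ℕ → ℝ, ∑ k ∈ Finset.range (n + 1), w k * e k =
      ∑ k ∈ Finset.range n, (1 - p) * p ^ k * e k + p ^ n * e n := fun e => by
    rw [Finset.sum_range_succ, hwn]
    congr 1
    exact Finset.sum_congr rfl fun k hk => by simp only [w, if_pos (Finset.mem_range.1 hk)]
  have hw1 : ∑ k ∈ Finset.range (n + 1), w k = 1 := by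
    have h := hsum fun _ => 1
    have h' := sum_range_chain_weights p 0 1 0 0 m
    simp only [mul_one] at h
    simp at h'
    rw [h, h', hn]; ring
  have hdist : ∀ k t, phiStandard φ (fun ω => X t ω - X (π k t) ω) μ ≤ β * p ^ (k + 1) :=
    fun k t => by
      refine (hσ _ (by positivity) t _ (hπ k t)).trans (le_of_eq ?_)
      rw [Real.mul_rpow (by positivity) (Real.exp_pos _).le, ← mul_assoc, ← hβ, ← Real.exp_mul]
      congr 1
      nth_rw 2 [← Real.exp_log hp0]
      rw [← Real.exp_nat_mul]
      congr 1
      push_cast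
      field_simp
  have hmono : φ (β * l) ≤ D := hφ.le_of_abs_le (by
    rw [abs_mul, abs_mul, abs_div, abs_of_pos hq]
    gcongr
    exact le_div_self (abs_nonneg l) hq (by linarith))
  have hc : ∀ k ≤ n, ∀ s ∈ W k, ∫⁻ ω, ENNReal.ofReal
      (Real.exp (l / w k * (X s ω - if k = 0 then 0 else X (π (k - 1) s) ω))) ∂μ ≤
        ENNReal.ofReal (Real.exp (if k = 0 then A else D)) := by
    intro k hk s _
    rcases Nat.eq_zero_or_pos k with rfl | hk0
    · have hw0 : w 0 = 1 - p := by simp [w, hn]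
      simpa [hw0, hA] using ((hX s).bound_of_le hφ (hγ s)).lintegral_le (l / (1 - p))
    · obtain ⟨j, rfl⟩ : ∃ j, k = j + 1 := ⟨k - 1, by omega⟩
      have h1 := (((hX s).sub hφ (hX (π j s))).bound_of_le hφ (hdist j s)).lintegral_le
        (l / w (j + 1))
      simp only [Nat.succ_ne_zero, if_false, Nat.add_sub_cancel]
      refine h1.trans (ENNReal.ofReal_le_ofReal (Real.exp_le_exp.2 ?_))
      have hpj : p ^ (j + 1) ≠ 0 := by positivity
      rcases hk.lt_or_eq with hlt | heq
      -- The power in the weight cancels that in the standard, leaving `β l / (1 - p)`; at the last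
      -- level only `β l` is left, which `hmono` covers.
      · have : w (j + 1) = (1 - p) * p ^ (j + 1) := if_pos hlt
        rw [this, hD]
        apply le_of_eq
        congr 1
        field_simp
      · have : w (j + 1) = p ^ (j + 1) := by rw [heq, hwn]
        rw [this]
        refine le_trans (le_of_eq ?_) hmono
        congr 1
        field_simp
  have hchain := lintegral_iSup_exp_le_prod_chain X (fun t => (hX t).1) W π n
    (fun k hk s _ => by simpa only [W, if_pos hk] using hπV k s) w hw hw1 l
    (fun k => ENNReal.ofReal (Real.exp (if k = 0 then A else D))) hc
  rw [hWn] at hchain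
  -- The `+ 1` in `log (F.card + 1)` keeps the argument positive for empty `F`.
  let e : ℕ → ℝ := fun k => if k < n then
    ((k : ℝ) + 1) * (-Real.log p / α) + Real.log (1 + p) + (if k = 0 then A else D)
    else Real.log (F.card + 1) + D
  have hprod := prod_ofReal_exp_rpow_le (Finset.range (n + 1))
    (fun k => ((W k).card : ENNReal) * ENNReal.ofReal (Real.exp (if k = 0 then A else D))) w e
    (fun k hk => (hw k (Nat.lt_succ_iff.1 (Finset.mem_range.1 hk))).le) (fun k hk => by
      have hcast : ((W k).card : ENNReal) = ENNReal.ofReal ((W k).card : ℝ) :=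
        (ENNReal.ofReal_natCast _).symm
      rw [hcast, ← ENNReal.ofReal_mul (Nat.cast_nonneg _)]
      refine ENNReal.ofReal_le_ofReal ?_
      by_cases hkn : k < n
      · simp only [W, e, if_pos hkn]
        rw [Real.exp_add _ (if k = 0 then A else D)]
        gcongr
        exact hVcard k
      · have hk0 : k ≠ 0 := by omega
        simp only [W, e, if_neg hkn, if_neg hk0]
        rw [Real.exp_add, Real.exp_log (by positivity)]
        gcongr
        linarith)
  refine hchain.trans (hprod.trans (ENNReal.ofReal_le_ofReal (Real.exp_le_exp.2 ?_)))
  rw [hsum]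
  have he : ∑ k ∈ Finset.range n, (1 - p) * p ^ k * e k = _ := (Finset.sum_congr rfl
    fun k hk => by simp only [e, if_pos (Finset.mem_range.1 hk)]).trans
      (sum_range_chain_weights p (-Real.log p / α) (Real.log (1 + p)) A D m)
  rw [he]
  have hen : e n = Real.log (F.card + 1) + D := if_neg (lt_irrefl n)
  rw [hen, supMomentBound, ← hA, ← hD, ← hn]
  have hS : (∑ k ∈ Finset.range n, (1 - p) * p ^ k * ((k : ℝ) + 1)) * (-Real.log p / α) ≤
      (1 - Real.log p) / α := by
    have h1 := sum_range_geometric_mul_succ p n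
    have h2 : (∑ k ∈ Finset.range n, (1 - p) * p ^ k * ((k : ℝ) + 1)) ≤ 1 / (1 - p) := by
      rw [le_div_iff₀ hq, h1]
      have : 0 < p ^ n := by positivity
      have : 0 ≤ (n : ℝ) * p ^ n * (1 - p) := by positivity
      linarith
    calc _ ≤ 1 / (1 - p) * (-Real.log p / α) := by gcongr
      _ = -Real.log p / (1 - p) / α := by field_simp
      _ ≤ (-Real.log p + 1) / α := by
        gcongr
        exact neg_log_div_one_sub_le hp0 hp1
      _ = _ := by ring
  have hlog : (1 - p ^ n) * Real.log (1 + p) ≤ Real.log (1 + p) := by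
    have h1 : 0 ≤ Real.log (1 + p) := Real.log_nonneg (by linarith)
    have h2 : 0 < p ^ n := by positivity
    nlinarith
  linarith

/-- Let `m → ∞`: the left side does not depend on `m` and the cost of `F` vanishes. -/
lemma lintegral_iSup_finset_exp_le (hφ : IsOrliczNFunction φ) (hT : 0 < T)
    (hX : ∀ t, IsPhiSubGaussian φ (X t) μ) (hC : 0 ≤ C) (hα0 : 0 < α) (hα1 : α < 1)
    (hσ : ∀ h : ℝ, 0 < h → ∀ t s : Set.Icc (0 : ℝ) T, |(t : ℝ) - (s : ℝ)| ≤ h →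
      phiStandard φ (fun ω => X t ω - X s ω) μ ≤ C * h ^ α)
    (hβ : β = C * (T / 2) ^ α) (hγ : ∀ t, phiStandard φ (X t) μ ≤ γ)
    (hp0 : 0 < p) (hp1 : p < 1) (l : ℝ) (F : Finset (Set.Icc (0 : ℝ) T)) :
    ∫⁻ ω, ⨆ t ∈ F, ENNReal.ofReal (Real.exp (l * X t ω)) ∂μ ≤
      ENNReal.ofReal (Real.exp (supMomentBound φ α β γ p l)) := by
  have hlim : Tendsto (fun m : ℕ => ENNReal.ofReal (Real.exp (supMomentBound φ α β γ p l +
      p ^ (m + 1) * Real.log (F.card + 1)))) atTop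
      (𝓝 (ENNReal.ofReal (Real.exp (supMomentBound φ α β γ p l + 0 * Real.log (F.card + 1))))) := by
    refine ENNReal.tendsto_ofReal ((Real.continuous_exp.tendsto _).comp
      (tendsto_const_nhds.add (Tendsto.mul_const _ ?_)))
    exact (tendsto_pow_atTop_nhds_zero_of_lt_one hp0.le hp1).comp (tendsto_add_atTop_nat 1)
  rw [zero_mul, add_zero] at hlim
  exact ge_of_tendsto' hlim fun m =>
    lintegral_iSup_finset_exp_le_of_level hφ hT hX hC hα0 hα1 hσ hβ hγ hp0 hp1 l F m

/-- Monotone convergence along the directed family of finite subsets of `S`. -/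
lemma lintegral_iSup_le_of_finset {B : Type*} {S : Set B} (hS : S.Countable)
    {f : B → Ω → ENNReal} (hf : ∀ t, AEMeasurable (f t) μ) {c : ENNReal}
    (h : ∀ F : Finset B, ∫⁻ ω, ⨆ t ∈ F, f t ω ∂μ ≤ c) :
    ∫⁻ ω, ⨆ t : S, f t ω ∂μ ≤ c := by
  classical
  have := hS.to_subtype
  have e : ∀ ω, ⨆ t : S, f t ω = ⨆ F : Finset S, ⨆ t ∈ F, f t ω := fun ω =>
    iSup_eq_iSup_finset _
  simp only [e]
  rw [lintegral_iSup_directed]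
  · refine iSup_le fun F => ?_
    refine le_trans (lintegral_mono fun ω => ?_) (h (F.image Subtype.val))
    exact iSup₂_le fun t ht => le_iSup₂_of_le (t : B) (Finset.mem_image_of_mem _ ht) le_rfl
  · exact fun F => AEMeasurable.biSup _ F.countable_toSet fun t _ => hf t
  · refine directed_of_isDirected_le fun F G hFG ω => ?_
    exact biSup_mono fun t ht => hFG ht

/-- The exponential moment of the supremum over a countable set. -/
lemma lintegral_iSup_exp_le (hφ : IsOrliczNFunction φ) (hT : 0 < T)
    (hX : ∀ t, IsPhiSubGaussian φ (X t) μ) (hC : 0 ≤ C) (hα0 : 0 < α) (hα1 : α < 1)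
    (hσ : ∀ h : ℝ, 0 < h → ∀ t s : Set.Icc (0 : ℝ) T, |(t : ℝ) - (s : ℝ)| ≤ h →
      phiStandard φ (fun ω => X t ω - X s ω) μ ≤ C * h ^ α)
    (hβ : β = C * (T / 2) ^ α) (hγ : ∀ t, phiStandard φ (X t) μ ≤ γ)
    (hp0 : 0 < p) (hp1 : p < 1) (l : ℝ) {S : Set (Set.Icc (0 : ℝ) T)} (hS : S.Countable) :
    ∫⁻ ω, ⨆ t : S, ENNReal.ofReal (Real.exp (l * X t ω)) ∂μ ≤
      ENNReal.ofReal (Real.exp (supMomentBound φ α β γ p l)) :=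
  lintegral_iSup_le_of_finset hS (f := fun t ω => ENNReal.ofReal (Real.exp (l * X t ω)))
    (fun t => (Real.measurable_exp.comp_aemeasurable ((hX t).1.const_mul l)).ennreal_ofReal)
    (lintegral_iSup_finset_exp_le hφ hT hX hC hα0 hα1 hσ hβ hγ hp0 hp1 l)

end Chaining

/-! ### Optimising the Chernoff bound. -/

section TailBound

variable {ζ α β γ x : ℝ}

/-- The exponent of `tailBound` in terms of the optimal parameter of the Chernoff bound. -/
lemma tailBound_eq (hζ : 2 ≤ ζ) (hβ : 0 ≤ β) (hγ : 0 < γ) (hx : γ < x) :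
    tailBound ζ α β γ x = Real.exp (-((ζ - 1) / ζ *
      (((x - γ) * x / (γ ^ ζ * (x - γ) + β ^ ζ * γ)) ^ (1 / (ζ - 1)) * (x - γ)))) *
        (2 * Real.exp ((1 - Real.log (γ / x)) / α)) := by
  have hxγ : 0 < x - γ := by linarith
  have hx0 : 0 < x := by linarith
  have hD : 0 < γ ^ ζ * (x - γ) + β ^ ζ * γ := by
    have : 0 ≤ β ^ ζ := Real.rpow_nonneg hβ ζ
    positivity
  have hζ1 : ζ - 1 ≠ 0 := by linarith
  have hζ0 : ζ ≠ 0 := by linarith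
  rw [tailBound]
  congr 2
  · congr 1
    rw [Real.div_rpow (by positivity) hD.le, Real.mul_rpow hxγ.le hx0.le]
    have : (x - γ) ^ (ζ / (ζ - 1)) = (x - γ) ^ (1 / (ζ - 1)) * (x - γ) := by
      rw [← Real.rpow_add_one hxγ.ne']
      congr 1
      field_simp
      ring
    rw [this]
    have := (Real.rpow_pos_of_pos hD (1 / (ζ - 1))).ne'
    field_simp
  · rw [Real.rpow_def_of_pos (by positivity), mul_div_assoc,
      Real.log_mul (Real.exp_pos _).ne' (by positivity), Real.log_exp,
      Real.log_div hx0.ne' hγ.ne', Real.log_div hγ.ne' hx0.ne']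
    ring_nf

/-- Near `γ` the exponential factor is at least `1/e`, while the entropy factor is at least `2e`. -/
lemma one_le_tailBound (hζ : 2 ≤ ζ) (hα0 : 0 < α) (hα1 : α < 1) (hβ : 0 ≤ β) (hγ : 0 < γ)
    (hx : γ < x) (hx2 : x ≤ 2 * γ) : 1 ≤ tailBound ζ α β γ x := by
  rw [tailBound_eq hζ hβ hγ hx]
  have hxγ : 0 < x - γ := by linarith
  have hx0 : 0 < x := by linarith
  have hζ1 : 0 < ζ - 1 := by linarith
  have hζ0 : 0 < ζ := by linarith
  have hβζ : 0 ≤ β ^ ζ := Real.rpow_nonneg hβ ζ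
  have hγζ : 0 < γ ^ ζ := Real.rpow_pos_of_pos hγ ζ
  have hγζ1 : 0 < γ ^ (ζ - 1) := Real.rpow_pos_of_pos hγ _
  have hs0 : 0 ≤ 1 / (ζ - 1) := by positivity
  have hu : ((x - γ) * x / (γ ^ ζ * (x - γ) + β ^ ζ * γ)) ^ (1 / (ζ - 1)) ≤
      ζ / (ζ - 1) / γ := by
    have h1 : (x - γ) * x / (γ ^ ζ * (x - γ) + β ^ ζ * γ) ≤ x / γ / γ ^ (ζ - 1) := by
      have e : γ ^ ζ = γ ^ (ζ - 1) * γ := by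
        rw [← Real.rpow_add_one hγ.ne', sub_add_cancel]
      calc _ ≤ (x - γ) * x / (γ ^ ζ * (x - γ)) := by
            gcongr
            exact le_add_of_nonneg_right (by positivity)
        _ = _ := by rw [e]; field_simp
    refine (Real.rpow_le_rpow (by positivity) h1 hs0).trans ?_
    rw [Real.div_rpow (by positivity) hγζ1.le, ← Real.rpow_mul hγ.le,
      mul_one_div_cancel hζ1.ne', Real.rpow_one]
    gcongr
    -- Bernoulli's inequality for an exponent at most 1, which is where `ζ ≥ 2` is needed.
    have h2 := rpow_one_add_le_one_add_mul_self (s := (x - γ) / γ) (p := 1 / (ζ - 1))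
      (by have : 0 < (x - γ) / γ := by positivity
          linarith) hs0 (by rw [div_le_one hζ1]; linarith)
    have e : 1 + (x - γ) / γ = x / γ := by field_simp; ring
    rw [e] at h2
    have h3 : (x - γ) / γ ≤ 1 := by rw [div_le_one hγ]; linarith
    have h4 : 1 / (ζ - 1) * ((x - γ) / γ) ≤ 1 / (ζ - 1) * 1 := by gcongr
    have h5 : ζ / (ζ - 1) = 1 + 1 / (ζ - 1) * 1 := by field_simp; ring
    linarith
  have hE : (ζ - 1) / ζ *
      (((x - γ) * x / (γ ^ ζ * (x - γ) + β ^ ζ * γ)) ^ (1 / (ζ - 1)) * (x - γ)) ≤ 1 := by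
    calc _ ≤ (ζ - 1) / ζ * (ζ / (ζ - 1) / γ * γ) := by
          gcongr
          linarith
      _ = 1 := by field_simp
  have hlog : 1 ≤ (1 - Real.log (γ / x)) / α := by
    rw [le_div_iff₀ hα0]
    have := Real.log_neg (by positivity : 0 < γ / x) (by rwa [div_lt_one hx0])
    linarith
  have h1 := Real.exp_le_exp.2 (neg_le_neg hE)
  have h2 := Real.exp_le_exp.2 hlog
  calc (1 : ℝ) ≤ 2 := by norm_num
    _ = Real.exp (-1) * (2 * Real.exp 1) := by
      rw [mul_left_comm, ← Real.exp_add]; norm_num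
    _ ≤ _ := by gcongr

lemma exists_exp_supMomentBound_le_tailBound {φ : ℝ → ℝ} (hφ : IsOrliczNFunction φ)
    (hζ : 2 ≤ ζ) (hφζ : ∀ t : ℝ, 1 < t → φ t = t ^ ζ / ζ)
    (hβ : 0 ≤ β) (hγ : 0 < γ) (hx2 : 2 * γ ≤ x) :
    ∃ p l : ℝ, 0 < p ∧ p < 1 ∧ 0 < l ∧
      Real.exp (supMomentBound φ α β γ p l - l * x) ≤ tailBound ζ α β γ x := by
  have hx : γ < x := by linarith
  have hxγ : 0 < x - γ := by linarith
  have hx0 : 0 < x := by linarith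
  have hζ1 : 0 < ζ - 1 := by linarith
  have hζ0 : 0 < ζ := by linarith
  have hβζ : 0 ≤ β ^ ζ := Real.rpow_nonneg hβ ζ
  rw [tailBound_eq hζ hβ hγ hx]
  set D := γ ^ ζ * (x - γ) + β ^ ζ * γ with hD
  have hD0 : 0 < D := by positivity
  -- The minimiser of `u^ζ D/(ζx) - u(x - γ)`, the Chernoff exponent in `u = l/(1-p)` at `p = γ/x`.
  set u := ((x - γ) * x / D) ^ (1 / (ζ - 1)) with hu
  have hu0 : 0 < u := Real.rpow_pos_of_pos (by positivity) _
  have huζ : u ^ ζ * D = u * (x - γ) * x := by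
    have h1 : u ^ (ζ - 1) = (x - γ) * x / D := by
      rw [hu, ← Real.rpow_mul (by positivity), one_div_mul_cancel hζ1.ne', Real.rpow_one]
    have h2 : u ^ ζ = u ^ (ζ - 1) * u := by rw [← Real.rpow_add_one hu0.ne', sub_add_cancel]
    rw [h2, h1]
    field_simp
  have hp2 : γ / x ≤ 1 / 2 := by rw [div_le_iff₀ hx0]; linarith
  have hp0 : 0 < γ / x := by positivity
  refine ⟨γ / x, u * (x - γ) / x, hp0, by linarith, by positivity, ?_⟩
  have hl : u * (x - γ) / x / (1 - γ / x) = u := by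
    rw [one_sub_div hx0.ne']; field_simp
  rw [supMomentBound, hl]
  have h1 := hφ.le_rpow_div_add hζ hφζ (mul_nonneg hγ.le hu0.le)
  have h2 := hφ.le_rpow_div_add hζ hφζ (mul_nonneg hβ hu0.le)
  rw [Real.mul_rpow hγ.le hu0.le] at h1
  rw [Real.mul_rpow hβ hu0.le] at h2
  have h3 : (1 - γ / x) * φ (γ * u) + γ / x * φ (β * u) ≤ u * (x - γ) / ζ + 1 / 4 := by
    calc _ ≤ (1 - γ / x) * (γ ^ ζ * u ^ ζ / ζ + 1 / 4) + γ / x * (β ^ ζ * u ^ ζ / ζ + 1 / 4) := by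
          gcongr
          linarith
      _ = u ^ ζ * D / (ζ * x) + 1 / 4 := by rw [hD]; field_simp; ring
      _ = _ := by rw [huζ]; field_simp
  -- This absorbs both errors into the prefactor 2: `γ/x ≤ 1/2` and `log(4/3) ≥ 1/4`.
  have h4 : Real.log (1 + γ / x) + 1 / 4 ≤ Real.log 2 := by
    have h5 : Real.log (1 + γ / x) ≤ Real.log (3 / 2) :=
      Real.log_le_log (by linarith) (by linarith)
    have h6 := Real.one_sub_inv_le_log_of_pos (by norm_num : (0 : ℝ) < 4 / 3)
    have h7 : Real.log 2 = Real.log (3 / 2) + Real.log (4 / 3) := by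
      rw [← Real.log_mul (by norm_num) (by norm_num)]; norm_num
    norm_num at h6
    linarith
  have h8 : (2 : ℝ) = Real.exp (Real.log 2) := (Real.exp_log (by norm_num)).symm
  nth_rw 1 [h8]
  rw [← Real.exp_add, ← Real.exp_add, Real.exp_le_exp]
  have h9 : u * (x - γ) / x * x = u * (x - γ) := by field_simp
  have h10 : (ζ - 1) / ζ * (u * (x - γ)) = u * (x - γ) - u * (x - γ) / ζ := by field_simp
  rw [h9, h10]
  linarith

/-- With `a = ν^(ζ-1)`, the radicand is at least `γ²(a+1)² - 4aγ² = γ²(a-1)²`. -/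
lemma le_tailThreshold {C T ν : ℝ} (hC : 0 ≤ C) (hT : 0 < T) (hν : 0 < ν) :
    γ ≤ tailThreshold ζ α C T γ ν := by
  have ha : 0 < ν ^ (ζ - 1) := Real.rpow_pos_of_pos hν _
  rw [tailThreshold]
  set a := ν ^ (ζ - 1)
  have hb : 0 ≤ C ^ ζ * (T / 2) ^ (α * ζ) :=
    mul_nonneg (Real.rpow_nonneg hC _) (Real.rpow_nonneg (by positivity) _)
  set b := C ^ ζ * (T / 2) ^ (α * ζ)
  have : γ * (a - 1) ≤ Real.sqrt (γ ^ 2 * (a + 1) ^ 2 + 4 * a * (b - γ ^ 2)) := by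
    refine Real.le_sqrt_of_sq_le ?_
    nlinarith [mul_nonneg ha.le hb]
  rw [le_div_iff₀ (by positivity)]
  linarith

end TailBound

/-! ### Suprema over a countable set. -/

section Supremum

variable {Ω : Type*} [MeasurableSpace Ω] {μ : Measure Ω} {φ : ℝ → ℝ}

lemma supMomentBound_neg (hφ : IsOrliczNFunction φ) (α β γ p l : ℝ) :
    supMomentBound φ α β γ p (-l) = supMomentBound φ α β γ p l := by
  simp only [supMomentBound, neg_div, mul_neg, hφ.even]

variable {T : ℝ} {X : Set.Icc (0 : ℝ) T → Ω → ℝ} {C α β γ : ℝ}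

/-- A real `⨆` of an unbounded family is 0, so boundedness has to be proved: compare `X s` with `X
0` through the increment. -/
lemma phiStandard_le_supStandard (hφ : IsOrliczNFunction φ) (hT : 0 < T)
    (hX : ∀ t, IsPhiSubGaussian φ (X t) μ) (hC : 0 ≤ C)
    (hσ : ∀ h : ℝ, 0 < h → ∀ t s : Set.Icc (0 : ℝ) T, |(t : ℝ) - (s : ℝ)| ≤ h →
      phiStandard φ (fun ω => X t ω - X s ω) μ ≤ C * h ^ α) (t : Set.Icc (0 : ℝ) T) :
    phiStandard φ (X t) μ ≤ supStandard φ X μ := by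
  let o : Set.Icc (0 : ℝ) T := ⟨0, le_rfl, hT.le⟩
  refine le_ciSup (f := fun t => phiStandard φ (X t) μ)
    ⟨2 * max (C * T ^ α) (phiStandard φ (X o) μ), ?_⟩ t
  rintro _ ⟨s, rfl⟩
  have h1 := ((hX s).sub hφ (hX o)).bound_of_le hφ (hσ T hT s o (by
    rw [show ((o : Set.Icc (0 : ℝ) T) : ℝ) = 0 from rfl, sub_zero, abs_of_nonneg s.2.1]
    exact s.2.2))
  have h2 := h1.add hφ ((hX s).1.sub (hX o).1) (hX o).1 (by positivity) phiStandard_nonneg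
    ((hX o).bound_phiStandard hφ)
  have e : (fun ω => X s ω - X o ω + X o ω) = X s := funext fun ω => sub_add_cancel _ _
  change SubGaussianBound φ (fun ω => X s ω - X o ω + X o ω) μ _ at h2
  rw [e] at h2
  exact phiStandard_le (mul_nonneg zero_le_two (le_max_of_le_left (by positivity))) h2

/-- The bound `tailBound` holds for the supremum over a countable set of either `X` or `-X`, at
every level above `γ`. -/
lemma measure_exists_lt_le_tailBound [IsProbabilityMeasure μ] (hφ : IsOrliczNFunction φ)
    {ζ : ℝ} (hζ : 2 ≤ ζ) (hφζ : ∀ t : ℝ, 1 < t → φ t = t ^ ζ / ζ) (hT : 0 < T)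
    (hX : ∀ t, IsPhiSubGaussian φ (X t) μ) (hC : 0 ≤ C) (hα0 : 0 < α) (hα1 : α < 1)
    (hσ : ∀ h : ℝ, 0 < h → ∀ t s : Set.Icc (0 : ℝ) T, |(t : ℝ) - (s : ℝ)| ≤ h →
      phiStandard φ (fun ω => X t ω - X s ω) μ ≤ C * h ^ α)
    (hβ : β = C * (T / 2) ^ α) (hγ : ∀ t, phiStandard φ (X t) μ ≤ γ) (hγ0 : 0 < γ)
    {S : Set (Set.Icc (0 : ℝ) T)} (hS : S.Countable) {x : ℝ} (hx : γ < x)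
    {ε : ℝ} (hε : ε = 1 ∨ ε = -1) :
    μ {ω | ∃ t : S, x < ε * X t ω} ≤ ENNReal.ofReal (tailBound ζ α β γ x) := by
  have hβ0 : 0 ≤ β := by rw [hβ]; positivity
  rcases le_total x (2 * γ) with hx2 | hx2
  · exact prob_le_one.trans
      (ENNReal.one_le_ofReal.2 (one_le_tailBound hζ hα0 hα1 hβ0 hγ0 hx hx2))
  obtain ⟨p, l, hp0, hp1, hl, hle⟩ :=
    exists_exp_supMomentBound_le_tailBound (α := α) hφ hζ hφζ hβ0 hγ0 hx2
  have hQ := lintegral_iSup_exp_le hφ hT hX hC hα0 hα1 hσ hβ hγ hp0 hp1 (ε * l) hS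
  have hQε : supMomentBound φ α β γ p (ε * l) = supMomentBound φ α β γ p l := by
    rcases hε with rfl | rfl
    · rw [one_mul]
    · rw [neg_one_mul, supMomentBound_neg hφ]
  rw [hQε] at hQ
  have := hS.to_subtype
  have hmeas : AEMeasurable
      (fun ω => ⨆ t : S, ENNReal.ofReal (Real.exp (ε * l * X t ω))) μ :=
    AEMeasurable.iSup fun t =>
      (Real.measurable_exp.comp_aemeasurable ((hX t).1.const_mul _)).ennreal_ofReal
  calc μ {ω | ∃ t : S, x < ε * X t ω}
      ≤ μ {ω | ENNReal.ofReal (Real.exp (l * x)) ≤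
          ⨆ t : S, ENNReal.ofReal (Real.exp (ε * l * X t ω))} := by
        refine measure_mono ?_
        rintro ω ⟨t, ht⟩
        refine le_trans (ENNReal.ofReal_le_ofReal (Real.exp_le_exp.2 ?_))
          (le_iSup (fun t : S => ENNReal.ofReal (Real.exp (ε * l * X t ω))) t)
        nlinarith
    _ ≤ _ := meas_ge_le_lintegral_div hmeas (by simp [Real.exp_pos]) ENNReal.ofReal_ne_top
    _ ≤ ENNReal.ofReal (Real.exp (supMomentBound φ α β γ p l)) /
          ENNReal.ofReal (Real.exp (l * x)) := by gcongr
    _ ≤ _ := by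
        rw [← ENNReal.ofReal_div_of_pos (Real.exp_pos _), ← Real.exp_sub]
        exact ENNReal.ofReal_le_ofReal hle

lemma ae_exists_forall_mul_le (hφ : IsOrliczNFunction φ) (hT : 0 < T)
    (hX : ∀ t, IsPhiSubGaussian φ (X t) μ) (hC : 0 ≤ C) (hα0 : 0 < α) (hα1 : α < 1)
    (hσ : ∀ h : ℝ, 0 < h → ∀ t s : Set.Icc (0 : ℝ) T, |(t : ℝ) - (s : ℝ)| ≤ h →
      phiStandard φ (fun ω => X t ω - X s ω) μ ≤ C * h ^ α)
    (hγ : ∀ t, phiStandard φ (X t) μ ≤ γ) {S : Set (Set.Icc (0 : ℝ) T)} (hS : S.Countable)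
    (l : ℝ) : ∀ᵐ ω ∂μ, ∃ M : ℝ, ∀ t ∈ S, l * X t ω ≤ M := by
  -- Any `p` in `(0,1)` would do; only finiteness of the moment matters.
  have hQ := lintegral_iSup_exp_le hφ hT hX hC hα0 hα1 hσ rfl hγ
    (by norm_num : (0 : ℝ) < 1 / 2) (by norm_num) l hS
  have := hS.to_subtype
  have hmeas : AEMeasurable (fun ω => ⨆ t : S, ENNReal.ofReal (Real.exp (l * X t ω))) μ :=
    AEMeasurable.iSup fun t =>
      (Real.measurable_exp.comp_aemeasurable ((hX t).1.const_mul _)).ennreal_ofReal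
  filter_upwards [ae_lt_top' hmeas (hQ.trans_lt ENNReal.ofReal_lt_top).ne] with ω hω
  refine ⟨(⨆ t : S, ENNReal.ofReal (Real.exp (l * X t ω))).toReal, fun t ht => ?_⟩
  have h1 : Real.exp (l * X t ω) ≤
      (⨆ t : S, ENNReal.ofReal (Real.exp (l * X t ω))).toReal :=
    (ENNReal.ofReal_le_iff_le_toReal hω.ne).1
      (le_iSup (fun t : S => ENNReal.ofReal (Real.exp (l * X t ω))) ⟨t, ht⟩)
  linarith [Real.add_one_le_exp (l * X t ω)]

end Supremum

/-! ### Passage to the whole interval by separability. -/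

theorem theorem6 {Ω : Type*} [MeasurableSpace Ω] (μ : Measure Ω) [IsProbabilityMeasure μ]
    (φ : ℝ → ℝ) (hφ : IsOrliczNFunction φ) (hQ : AssumptionQ φ)
    (ζ : ℝ) (hζ : 2 ≤ ζ) (hφζ : ∀ t : ℝ, 1 < t → φ t = t ^ ζ / ζ)
    (T : ℝ) (hT : 0 < T)
    (X : Set.Icc (0 : ℝ) T → Ω → ℝ)
    (hX : ∀ t, IsPhiSubGaussian φ (X t) μ)
    (hsep : IsSeparableProcess X μ)
    (C α : ℝ) (hC : 0 ≤ C) (hα0 : 0 < α) (hα1 : α < 1)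
    (hσ : ∀ h : ℝ, 0 < h → ∀ t s : Set.Icc (0 : ℝ) T, |(t : ℝ) - (s : ℝ)| ≤ h →
      phiStandard φ (fun ω => X t ω - X s ω) μ ≤ C * h ^ α)
    (β γ ν : ℝ) (hβ : β = C * (T / 2) ^ α) (hγ : γ = supStandard φ X μ) (hν : ν = min β γ) :
    (∀ᵐ ω ∂μ, ∃ M : ℝ, ∀ t, |X t ω| ≤ M) ∧
    (0 < ν → ∀ x : ℝ, tailThreshold ζ α C T γ ν < x →
      μ {ω | (x : EReal) < (⨆ t, (X t ω : EReal))} ≤ ENNReal.ofReal (tailBound ζ α β γ x) ∧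
      μ {ω | (⨅ t, (X t ω : EReal)) < ((-x : ℝ) : EReal)} ≤
        ENNReal.ofReal (tailBound ζ α β γ x) ∧
      μ {ω | (x : EReal) < ⨆ t, ((|X t ω| : ℝ) : EReal)} ≤
        ENNReal.ofReal (2 * tailBound ζ α β γ x)) := by
  have hγ' : ∀ t, phiStandard φ (X t) μ ≤ γ := fun t => by
    rw [hγ]; exact phiStandard_le_supStandard hφ hT hX hC hσ t
  obtain ⟨S, hS, -, hsep⟩ := hsep
  have hsep' : ∀ᵐ ω ∂μ, ∀ F : Set ℝ, IsClosed F → F.OrdConnected →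
      (∀ t ∈ S, X t ω ∈ F) → ∀ t, X t ω ∈ F := by
    filter_upwards [hsep] with ω h F hF hF' hS t
    exact h Set.univ isOpen_univ F hF hF' (fun t ht => hS t ht.2) t trivial
  refine ⟨?_, fun hν0 x hx => ?_⟩
  · filter_upwards [hsep', ae_exists_forall_mul_le hφ hT hX hC hα0 hα1 hσ hγ' hS 1,
      ae_exists_forall_mul_le hφ hT hX hC hα0 hα1 hσ hγ' hS (-1)] with ω h ⟨M, hM⟩ ⟨N, hN⟩
    have hmem := h (Set.Icc (-N) M) isClosed_Icc Set.ordConnected_Icc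
      fun t ht => ⟨by linarith [hN t ht], by linarith [hM t ht]⟩
    refine ⟨max M N, fun t => abs_le.2 ⟨?_, (hmem t).2.trans (le_max_left _ _)⟩⟩
    linarith [(hmem t).1, le_max_right M N]
  have hγ0 : 0 < γ := hν0.trans_le (hν.le.trans (min_le_right _ _))
  have hxγ : γ < x := (le_tailThreshold hC hT hν0).trans_lt hx
  have hsup : μ {ω | ∃ t, x < X t ω} ≤ ENNReal.ofReal (tailBound ζ α β γ x) := by
    refine (measure_mono_ae ?_).trans (measure_exists_lt_le_tailBound hφ hζ hφζ hT hX hC hα0 hα1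
      hσ hβ hγ' hγ0 hS hxγ (Or.inl rfl))
    filter_upwards [hsep'] with ω h
    rintro ⟨t, ht⟩
    by_contra hcon
    have hcon : ∀ s ∈ S, X s ω ∈ Set.Iic x := fun s hs => by
      by_contra hs'
      exact hcon ⟨⟨s, hs⟩, by simpa using hs'⟩
    exact ht.not_ge (h _ isClosed_Iic Set.ordConnected_Iic hcon t)
  have hinf : μ {ω | ∃ t, X t ω < -x} ≤ ENNReal.ofReal (tailBound ζ α β γ x) := by
    refine (measure_mono_ae ?_).trans (measure_exists_lt_le_tailBound hφ hζ hφζ hT hX hC hα0 hα1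
      hσ hβ hγ' hγ0 hS hxγ (Or.inr rfl))
    filter_upwards [hsep'] with ω h
    rintro ⟨t, ht⟩
    by_contra hcon
    have hcon : ∀ s ∈ S, X s ω ∈ Set.Ici (-x) := fun s hs => by
      by_contra hs'
      have hs' : X s ω < -x := not_le.1 hs'
      exact hcon ⟨⟨s, hs⟩, by linarith⟩
    exact ht.not_ge (h _ isClosed_Ici Set.ordConnected_Ici hcon t)
  refine ⟨(measure_mono fun ω hω => ?_).trans hsup, (measure_mono fun ω hω => ?_).trans hinf, ?_⟩
  · obtain ⟨t, ht⟩ := lt_iSup_iff.1 (Set.mem_ofPred.1 hω)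
    exact ⟨t, EReal.coe_lt_coe_iff.1 ht⟩
  · obtain ⟨t, ht⟩ := iInf_lt_iff.1 (Set.mem_ofPred.1 hω)
    exact ⟨t, EReal.coe_lt_coe_iff.1 ht⟩
  · have hx0 : 0 < x := hγ0.trans hxγ
    have hZ : 0 ≤ tailBound ζ α β γ x := by rw [tailBound]; positivity
    rw [two_mul, ENNReal.ofReal_add hZ hZ]
    refine (measure_mono fun ω hω => ?_).trans
      ((measure_union_le _ _).trans (add_le_add hsup hinf))
    obtain ⟨t, ht⟩ := lt_iSup_iff.1 (Set.mem_ofPred.1 hω)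
    rcases lt_abs.1 (EReal.coe_lt_coe_iff.1 ht) with h | h
    · exact Or.inl ⟨t, h⟩
    · exact Or.inr ⟨t, by linarith⟩
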